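/- For $0<p<\infty$ let $\ell^p$ be the space of real sequences $x=(x_n)_{n\in\mathbb N}$ (with $0\in\mathbb N$) such that $\sum_n|x_n|^p<\infty$, with the metric $d_p(x,y)=\|x-y\|_p=\big(\sum_n|x_n-y_n|^p\big)^{1/p}$ if $p\ge 1$ and $d_p(x,y)=\sum_n|x_n-y_n|^p$ if $p<1$. For $0\le b<\infty$ let $\bigcap_{p>b}\ell^p$ carry the metric $\sum_{i=0}^\infty 2^{-(i+1)}\frac{d_{p_i}(x,y)}{1+d_{p_i}(x,y)}$, where $(p_i)_{i\in\mathbb N}$ is any fixed non-increasing sequence of reals $p_i>b$ converging to $b$, with $p_0<1$ if $b<1$. Let $\ell^\infty$ be the space of bounded real sequences with the supremum norm, and $c_0$ its subspace of sequences converging to $0$. In a topological space, $\mathbf\Sigma^0_1$ sets are the open sets, $\mathbf\Pi^0_n$ sets are the complements of $\mathbf\Sigma^0_n$ sets, and $\mathbf\Sigma^0_{n+1}$ sets are the countable unions of $\mathbf\Pi^0_n$ sets. A set $P\subseteq X$ is $\mathbf\Sigma^0_n$-complete if it is a $\mathbf\Sigma^0_n$ subset of $X$ and for every Polish space $Z$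 with a basis of clopen sets and every $\mathbf\Sigma^0_n$ set $A\subseteq Z$ there is a continuous $f:Z\to X$ with $A=f^{-1}[P]$; $\mathbf\Pi^0_n$-completeness is defined in the same way. Identify a sequence $x=(x_k)_{k\in\mathbb N}$ with the double sequence $(x_{m,n})_{m,n\in\mathbb N}$, $x_{m,n}=x_{\langle m,n\rangle}$, by means of the diagonal enumeration $\langle m,n\rangle=\frac{(m+n)(m+n+1)}2+n$, which is a bijection $\mathbb N^2\to\mathbb N$; its $m$-th row is $(x_{m,n})_{n\in\mathbb N}$. Let $0\le a<\infty$, and let $Y$ be one of the spaces $\ell^q$ with $a<q<\infty$, $\bigcap_{p>b}\ell^p$ with $a<b<\infty$, $c_0$, or $\ell^\infty$. Then $$A=\Big\{x\in Y : \exists m\ \ (x_{m,n})_{n\in\mathbb N}\in\bigcap_{p>a}\ell^p\Big\}$$ is a $\mathbf\Sigma^0_4$-complete subset of $Y$, and $$B=\Big\{x\in Y : \forall m\ \ (x_{m,n})_{n\in\mathbb N}\notin\bigcap_{p>a}\ell^p\Big\}$$ is a $\mathbf\Pi^0_4$-complete subset of $Y$. -/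

import Mathlib

open Set Filter Topology

universe u

/-! ### The finite levels of the Borel hierarchy and completeness -/

/-- `IsSigma n A`: the set `A` is `Σ⁰ₙ`. The levels are numbered from `1` (no set is `Σ⁰₀`):
`Σ⁰₁` sets are the open sets, and `Σ⁰ₙ₊₁` sets are the countable unions of sets with `Σ⁰ₙ`
complement. -/
def IsSigma {X : Type*} [TopologicalSpace X] : ℕ → Set X → Prop
  | 0, _ => False
  | 1, A => IsOpen A
  | n + 2, A => ∃ F : ℕ → Set X, (∀ i, IsSigma (n + 1) (F i)ᶜ) ∧ A = ⋃ i, F i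

/-- `IsPi n A`: the set `A` is `Π⁰ₙ`, that is, its complement is `Σ⁰ₙ`. -/
def IsPi {X : Type*} [TopologicalSpace X] (n : ℕ) (A : Set X) : Prop :=
  IsSigma n Aᶜ

/-- A space is zero-dimensional if its clopen sets form a basis of the topology. -/
def IsZeroDim (Z : Type*) [TopologicalSpace Z] : Prop :=
  TopologicalSpace.IsTopologicalBasis {U : Set Z | IsClopen U}

/-- `A ⊆ Z` continuously reduces to `B ⊆ X`. -/
def ContReduces {Z X : Type*} [TopologicalSpace Z] [TopologicalSpace X]
    (A : Set Z) (B : Set X) : Prop :=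
  ∃ f : Z → X, Continuous f ∧ A = f ⁻¹' B

/-- `P ⊆ X` is `Σ⁰ₙ`-complete: it is `Σ⁰ₙ`, and every `Σ⁰ₙ` subset of a zero-dimensional Polish
space continuously reduces to it. -/
def IsSigmaComplete {X : Type*} [TopologicalSpace X] (n : ℕ) (P : Set X) : Prop :=
  IsSigma n P ∧ ∀ (Z : Type u) [TopologicalSpace Z] [PolishSpace Z], IsZeroDim Z →
    ∀ A : Set Z, IsSigma n A → ContReduces A P

/-- `P ⊆ X` is `Π⁰ₙ`-complete: it is `Π⁰ₙ`, and every `Π⁰ₙ` subset of a zero-dimensional Polish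
space continuously reduces to it. -/
def IsPiComplete {X : Type*} [TopologicalSpace X] (n : ℕ) (P : Set X) : Prop :=
  IsPi n P ∧ ∀ (Z : Type u) [TopologicalSpace Z] [PolishSpace Z], IsZeroDim Z →
    ∀ A : Set Z, IsPi n A → ContReduces A P

/-! ### The sequence spaces -/

/-- The set `ℓᵖ` of real sequences with `∑ |xₙ|ᵖ < ∞` (used for `0 < p < ∞`). -/
def ellSet (p : ℝ) : Set (ℕ → ℝ) := {x | Summable fun n => |x n| ^ p}

/-- The set `⋂_{p > a} ℓᵖ`. -/
def ellAboveSet (a : ℝ) : Set (ℕ → ℝ) := ⋂ p > a, ellSet p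

/-- The distance of `ℓᵖ`: `‖x - y‖ₚ` if `1 ≤ p`, and `∑ |xₙ - yₙ|ᵖ` if `0 < p < 1`. -/
noncomputable def ellDist (p : ℝ) (x y : ℕ → ℝ) : ℝ :=
  if 1 ≤ p then (∑' n, |x n - y n| ^ p) ^ (1 / p) else ∑' n, |x n - y n| ^ p

theorem ellDist_nonneg (p : ℝ) (x y : ℕ → ℝ) : 0 ≤ ellDist p x y := by
  have h : 0 ≤ ∑' n, |x n - y n| ^ p := tsum_nonneg fun n => by positivity
  unfold ellDist
  split_ifs
  · positivity
  · exact h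

theorem ellDist_self {p : ℝ} (hp : 0 < p) (x : ℕ → ℝ) : ellDist p x x = 0 := by
  simp [ellDist, Real.zero_rpow hp.ne', hp.ne']

theorem ellDist_comm (p : ℝ) (x y : ℕ → ℝ) : ellDist p x y = ellDist p y x := by
  simp [ellDist, abs_sub_comm]

theorem ellSet_sub {p : ℝ} (hp : 0 < p) {x y : ℕ → ℝ} (hx : x ∈ ellSet p) (hy : y ∈ ellSet p) :
    Summable fun n => |x n - y n| ^ p := by
  have hp' : 0 < (ENNReal.ofReal p).toReal := by rwa [ENNReal.toReal_ofReal hp.le]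
  have key : ∀ z : ℕ → ℝ, Memℓp z (ENNReal.ofReal p) ↔ Summable fun n => |z n| ^ p := fun z => by
    rw [memℓp_gen_iff hp', ENNReal.toReal_ofReal hp.le]
    rfl
  exact (key _).1 (((key x).2 hx).sub ((key y).2 hy))

theorem ellDist_triangle {p : ℝ} (hp : 0 < p) {x y z : ℕ → ℝ} (hx : x ∈ ellSet p)
    (hy : y ∈ ellSet p) (hz : z ∈ ellSet p) :
    ellDist p x z ≤ ellDist p x y + ellDist p y z := by
  have h1 := ellSet_sub hp hx hy
  have h2 := ellSet_sub hp hy hz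
  have h3 := ellSet_sub hp hx hz
  have habs : ∀ n, |x n - z n| ≤ |x n - y n| + |y n - z n| := fun n => abs_sub_le _ _ _
  unfold ellDist
  split_ifs with h
  · have hM := Real.Lp_add_le_tsum_of_nonneg h (fun n => abs_nonneg (x n - y n))
      (fun n => abs_nonneg (y n - z n)) h1 h2
    refine le_trans ?_ hM.2
    refine Real.rpow_le_rpow (tsum_nonneg fun n => by positivity) ?_ (by positivity)
    exact h3.tsum_le_tsum (fun n => Real.rpow_le_rpow (abs_nonneg _) (habs n) hp.le) hM.1
  · rw [← h1.tsum_add h2]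
    refine h3.tsum_le_tsum (fun n => ?_) (h1.add h2)
    exact (Real.rpow_le_rpow (abs_nonneg _) (habs n) hp.le).trans
      (Real.rpow_add_le_add_rpow (abs_nonneg _) (abs_nonneg _) hp.le (not_le.1 h).le)

theorem eq_of_ellDist_eq_zero {p : ℝ} (hp : 0 < p) {x y : ℕ → ℝ} (hx : x ∈ ellSet p)
    (hy : y ∈ ellSet p) (h : ellDist p x y = 0) : x = y := by
  have h1 := ellSet_sub hp hx hy
  have h0 : ∀ n, 0 ≤ |x n - y n| ^ p := fun n => by positivity
  have hs : ∑' n, |x n - y n| ^ p = 0 := by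
    unfold ellDist at h
    split_ifs at h
    · exact ((Real.rpow_eq_zero_iff_of_nonneg (tsum_nonneg h0)).1 h).1
    · exact h
  funext n
  have hn := congrFun ((hasSum_zero_iff_of_nonneg h0).1 (hs ▸ h1.hasSum)) n
  have := ((Real.rpow_eq_zero_iff_of_nonneg (abs_nonneg _)).1 hn).1
  exact sub_eq_zero.1 (abs_eq_zero.1 this)

/-- The space `ℓ^q`, `0 < q < ∞`. -/
@[ext]
structure Ell (q : ℝ) (hq : 0 < q) where
  /-- the underlying sequence -/
  seq : ℕ → ℝ
  mem : seq ∈ ellSet q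

noncomputable instance Ell.instMetricSpace (q : ℝ) (hq : 0 < q) : MetricSpace (Ell q hq) where
  dist x y := ellDist q x.seq y.seq
  dist_self x := ellDist_self hq x.seq
  dist_comm x y := ellDist_comm q x.seq y.seq
  dist_triangle x y z := ellDist_triangle hq x.mem y.mem z.mem
  eq_of_dist_eq_zero {x y} h := Ell.ext (eq_of_ellDist_eq_zero hq x.mem y.mem h)

/-- A sequence of exponents `pᵢ ↓ b` used to metrize `⋂_{p > b} ℓᵖ`. -/
structure ExponentSeq (b : ℝ) where
  /-- the `i`-th exponent -/
  exp : ℕ → ℝ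
  pos : ∀ i, 0 < exp i
  gt : ∀ i, b < exp i
  anti : Antitone exp
  tendsto : Tendsto exp atTop (𝓝 b)
  lt_one : b < 1 → exp 0 < 1

/-- The space `⋂_{p > b} ℓᵖ`, metrized by means of the sequence of exponents `e`. -/
@[ext]
structure EllAbove (b : ℝ) (e : ExponentSeq b) where
  /-- the underlying sequence -/
  seq : ℕ → ℝ
  mem : seq ∈ ellAboveSet b

theorem EllAbove.mem_ell {b : ℝ} {e : ExponentSeq b} (x : EllAbove b e) (i : ℕ) :
    x.seq ∈ ellSet (e.exp i) :=
  mem_iInter₂.1 x.mem _ (e.gt i)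

/-- The distance `∑ᵢ 2^{-(i+1)} dᵢ(x,y) / (1 + dᵢ(x,y))`, where `dᵢ` is the distance of `ℓ^{pᵢ}`
(a norm distance for all `i` if `b ≥ 1`, as `pᵢ > 1` then, and a sum of powers for all `i` if
`b < 1`, as `pᵢ < 1` then). -/
noncomputable def ellAboveDist {b : ℝ} (e : ExponentSeq b) (x y : ℕ → ℝ) : ℝ :=
  ∑' i : ℕ, (1 / 2 : ℝ) ^ (i + 1) * (ellDist (e.exp i) x y / (1 + ellDist (e.exp i) x y))

theorem ellAboveDist_term_nonneg {b : ℝ} (e : ExponentSeq b) (x y : ℕ → ℝ) (i : ℕ) :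
    0 ≤ (1 / 2 : ℝ) ^ (i + 1) * (ellDist (e.exp i) x y / (1 + ellDist (e.exp i) x y)) := by
  have := ellDist_nonneg (e.exp i) x y
  positivity

theorem ellAboveDist_summable {b : ℝ} (e : ExponentSeq b) (x y : ℕ → ℝ) :
    Summable fun i : ℕ =>
      (1 / 2 : ℝ) ^ (i + 1) * (ellDist (e.exp i) x y / (1 + ellDist (e.exp i) x y)) := by
  refine Summable.of_nonneg_of_le (ellAboveDist_term_nonneg e x y) (fun i => ?_)
    ((summable_nat_add_iff 1).2 summable_geometric_two)
  have h := ellDist_nonneg (e.exp i) x y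
  exact mul_le_of_le_one_right (by positivity) ((div_le_one (by positivity)).2 (by linarith))

theorem div_one_add_triangle {r s t : ℝ} (hr : 0 ≤ r) (hs : 0 ≤ s) (ht : 0 ≤ t)
    (h : r ≤ s + t) : r / (1 + r) ≤ s / (1 + s) + t / (1 + t) := by
  have h1 : r / (1 + r) ≤ (s + t) / (1 + (s + t)) := by
    rw [div_le_div_iff₀ (by positivity) (by positivity)]
    nlinarith
  have h2 : s / (1 + (s + t)) ≤ s / (1 + s) := by gcongr; linarith
  have h3 : t / (1 + (s + t)) ≤ t / (1 + t) := by gcongr; linarith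
  rw [add_div] at h1
  linarith

noncomputable instance EllAbove.instMetricSpace (b : ℝ) (e : ExponentSeq b) :
    MetricSpace (EllAbove b e) where
  dist x y := ellAboveDist e x.seq y.seq
  dist_self x := by simp [ellAboveDist, ellDist_self (e.pos _)]
  dist_comm x y := by simp [ellAboveDist, ellDist_comm _ x.seq y.seq]
  dist_triangle x y z := by
    have h1 := ellAboveDist_summable e x.seq y.seq
    have h2 := ellAboveDist_summable e y.seq z.seq
    have h3 := ellAboveDist_summable e x.seq z.seq
    unfold ellAboveDist
    rw [← h1.tsum_add h2]
    refine h3.tsum_le_tsum (fun i => ?_) (h1.add h2)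
    rw [← mul_add]
    exact mul_le_mul_of_nonneg_left
      (div_one_add_triangle (ellDist_nonneg _ _ _) (ellDist_nonneg _ _ _) (ellDist_nonneg _ _ _)
        (ellDist_triangle (e.pos i) (x.mem_ell i) (y.mem_ell i) (z.mem_ell i))) (by positivity)
  eq_of_dist_eq_zero {x y} h := by
    have hs := (ellAboveDist_summable e x.seq y.seq).hasSum
    have h' : ∑' i : ℕ, (1 / 2 : ℝ) ^ (i + 1) * (ellDist (e.exp i) x.seq y.seq /
      (1 + ellDist (e.exp i) x.seq y.seq)) = 0 := h
    rw [h'] at hs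
    have h0 := congrFun ((hasSum_zero_iff_of_nonneg (ellAboveDist_term_nonneg e x.seq y.seq)).1 hs) 0
    have hn := ellDist_nonneg (e.exp 0) x.seq y.seq
    have h1 : ellDist (e.exp 0) x.seq y.seq = 0 := by
      rcases mul_eq_zero.1 h0 with h0 | h0
      · norm_num at h0
      · rcases div_eq_zero_iff.1 h0 with h0 | h0
        · exact h0
        · linarith
    exact EllAbove.ext (eq_of_ellDist_eq_zero (e.pos 0) (x.mem_ell 0) (y.mem_ell 0) h1)

/-- The space `ℓ^∞` of bounded real sequences with the supremum norm. -/
abbrev EllInfty : Type := lp (fun _ : ℕ => ℝ) ⊤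

/-- The space `c₀` of real sequences that converge to `0`, as a subspace of `ℓ^∞`. -/
def cZero : Set EllInfty := {x | Tendsto (fun n => x n) atTop (𝓝 0)}

/-! ### Double sequences -/

/-- The diagonal enumeration of pairs `(0,0), (1,0), (0,1), (2,0), (1,1), (0,2), …`: the position
of the pair `(m, n)`. -/
def diagIndex (m n : ℕ) : ℕ := (m + n) * (m + n + 1) / 2 + n

theorem diagIndex_eq (m n : ℕ) : diagIndex m n = (∑ k ∈ Finset.range (m + n + 1), k) + n := by
  rw [diagIndex, Finset.sum_range_id, Nat.add_sub_cancel, mul_comm]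

/-- The diagonal enumeration is a bijection, so that double sequences and sequences are
identified by it. -/
theorem diagIndex_bijective : Function.Bijective fun i : ℕ × ℕ => diagIndex i.1 i.2 := by
  constructor
  · rintro ⟨m, n⟩ ⟨m', n'⟩ h
    simp only [diagIndex_eq] at h
    have key : ∀ {s t : ℕ}, s < t →
        (∑ k ∈ Finset.range (s + 1), k) + s < ∑ k ∈ Finset.range (t + 1), k := fun {s t} hst => by
      have h1 := Finset.sum_le_sum_of_subset (f := fun k : ℕ => k)
        (Finset.range_mono (show s + 2 ≤ t + 1 by omega))
      rw [Finset.sum_range_succ] at h1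
      omega
    rcases lt_trichotomy (m + n) (m' + n') with hlt | heq | hgt
    · have := key hlt
      omega
    · rw [heq] at h
      ext <;> simp <;> omega
    · have := key hgt
      omega
  · intro k
    induction k with
    | zero => exact ⟨(0, 0), rfl⟩
    | succ k ih =>
      obtain ⟨⟨m, n⟩, h⟩ := ih
      simp only [diagIndex_eq] at h
      cases m with
      | zero =>
        refine ⟨(n + 1, 0), ?_⟩
        simp only [diagIndex_eq]
        rw [show n + 1 + 0 + 1 = (0 + n + 1) + 1 by omega, Finset.sum_range_succ]
        omega
      | succ m =>
        refine ⟨(m, n + 1), ?_⟩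
        simp only [diagIndex_eq]
        rw [show m + (n + 1) + 1 = m + 1 + n + 1 by omega]
        omega

/-- The `m`-th row of the double sequence that is identified with the sequence `x`. -/
def row (x : ℕ → ℝ) (m : ℕ) : ℕ → ℝ := fun n => x (diagIndex m n)

/-- For a space `Y` of sequences, the set of its elements having some row in `⋂_{p > a} ℓᵖ`. -/
def someRowIn {Y : Type*} (a : ℝ) (seq : Y → ℕ → ℝ) : Set Y :=
  {y | ∃ m, row (seq y) m ∈ ellAboveSet a}

/-- For a space `Y` of sequences, the set of its elements having no row in `⋂_{p > a} ℓᵖ`. -/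
def noRowIn {Y : Type*} (a : ℝ) (seq : Y → ℕ → ℝ) : Set Y :=
  {y | ∀ m, row (seq y) m ∉ ellAboveSet a}

/-! ### Open and `Σ⁰₂` sets in zero-dimensional spaces -/

/-! Upper bound: membership in `ℓ^p` means bounded partial sums, a `Σ⁰₂` condition, and countably
many exponents suffice for `⋂_{p>a} ℓ^p`; so each row condition is `Π⁰₃`, and `∃ m` gives `Σ⁰₄`.

Hardness: write a `Π⁰₃` set as `⋂ₖ Sₖ` with `Sₖ` in `Σ⁰₂`, where `z ∈ Sₖ` iff `z` lies in finitely
many of clopen sets `D k i` (`IsZeroDim.exists_clopen_finite_iff`). Let exponents `r k` decrease to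
`a`. When `z ∈ D k i`, switch on a finite constant block whose `r (k+1)`-th powers sum to at least
`1`, while its `p`-th powers have sum at most `2^{-k-i}` for all `p ≥ r k` (`exists_block`).
Infinitely many active blocks at one level `k` destroy membership in `ℓ^{r (k+1)}`; finitely many at
every level leave the sequence in all `ℓ^p`, `p > a` (`exists_row_reduction`). Putting such
sequences in the rows, scaled by `2^{-m}`, handles `Σ⁰₄` sets.

All sequences produced are dominated by one element of `ℓ^q`, `q = r 0`, so coordinatewise
continuity gives continuity into each space `Y` (`isSigmaComplete_someRowIn`). The `Π⁰₄` statement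
follows by complements. -/

theorem IsZeroDim.exists_disjoint_clopen {Z : Type*} [TopologicalSpace Z]
    [SecondCountableTopology Z] (hZ : IsZeroDim Z) {U : Set Z} (hU : IsOpen U) :
    ∃ E : ℕ → Set Z, (∀ i, IsClopen (E i)) ∧ Pairwise (Function.onFun Disjoint E) ∧
      ⋃ i, E i = U := by
  obtain ⟨S, hS, rfl⟩ := TopologicalSpace.IsTopologicalBasis.open_eq_sUnion hZ hU
  obtain ⟨T, hT, hTS, hTU⟩ :=
    TopologicalSpace.isOpen_sUnion_countable S fun s hs => (hS hs).isOpen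
  obtain ⟨f, hf⟩ := (hT.insert ∅).exists_eq_range (insert_nonempty ∅ T)
  have hclopen : ∀ i, IsClopen (f i) := fun i => by
    have hi : f i ∈ insert ∅ T := hf ▸ mem_range_self i
    rcases hi with hi | hi
    · rw [hi]; exact isClopen_empty
    · exact hS (hTS hi)
  refine ⟨disjointed f, fun i => ?_, disjoint_disjointed f, ?_⟩
  · exact disjointedRec (p := IsClopen) (fun t i ht => ht.diff (hclopen i)) (hclopen i)
  · rw [iUnion_disjointed, ← sUnion_range, ← hf, sUnion_insert, empty_union, hTU]

/-- A `Σ⁰₂` subset of a zero-dimensional space consists of the points that lie in only finitely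
many members of a suitable sequence of clopen sets. -/
theorem IsZeroDim.exists_clopen_finite_iff {Z : Type*} [TopologicalSpace Z]
    [SecondCountableTopology Z] (hZ : IsZeroDim Z) {S : Set Z} (hS : IsSigma 2 S) :
    ∃ D : ℕ → Set Z, (∀ i, IsClopen (D i)) ∧ ∀ z, z ∈ S ↔ {i | z ∈ D i}.Finite := by
  obtain ⟨F, hF, rfl⟩ := hS
  have hF' : ∀ i, IsOpen (F i)ᶜ := hF
  -- These open sets decrease with `j`, and `z` lies in only finitely many of them iff some `F i`
  -- contains `z`. Splitting each into disjoint clopen pieces counts each `j` at most once.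
  have hU : ∀ j, IsOpen (⋂ i ∈ Iic j, (F i)ᶜ) := fun j =>
    (finite_Iic j).isOpen_biInter fun i _ => hF' i
  choose E hE hdisj hEU using fun j => hZ.exists_disjoint_clopen (hU j)
  refine ⟨fun s => E s.unpair.1 s.unpair.2, fun s => hE _ _, fun z => ?_⟩
  have hinj : InjOn (fun s : ℕ => s.unpair.1) {s | z ∈ E s.unpair.1 s.unpair.2} := by
    intro s hs t ht hst
    have hst' : s.unpair.1 = t.unpair.1 := hst
    have h2 : s.unpair.2 = t.unpair.2 := by
      by_contra hne
      refine Set.disjoint_left.1 (hdisj s.unpair.1 hne) hs ?_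
      rw [hst']
      exact ht
    rw [← Nat.pair_unpair s, ← Nat.pair_unpair t, hst', h2]
  have himage : (fun s : ℕ => s.unpair.1) '' {s | z ∈ E s.unpair.1 s.unpair.2} =
      {j | ∀ i ≤ j, z ∉ F i} := by
    ext j
    have hj : (∀ i ≤ j, z ∉ F i) ↔ ∃ i, z ∈ E j i := by
      rw [← mem_iUnion, hEU]
      simp
    rw [mem_ofPred_eq, hj]
    constructor
    · rintro ⟨s, hs, rfl⟩
      exact ⟨_, hs⟩
    · rintro ⟨i, hi⟩
      exact ⟨Nat.pair j i, by simpa using hi, by simp⟩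
  rw [← finite_image_iff hinj, himage, mem_iUnion]
  constructor
  · rintro ⟨i, hi⟩
    exact (finite_Iio i).subset fun j hj => not_le.1 fun hij => hj i hij hi
  · intro hfin
    by_contra! hne
    exact infinite_univ (hfin.subset fun j _ i _ => hne i)

/-! ### The sets `ellSet p` and `ellAboveSet a` -/

theorem isPi_compl_iff {X : Type*} [TopologicalSpace X] {n : ℕ} {A : Set X} :
    IsPi n Aᶜ ↔ IsSigma n A := by
  rw [IsPi, compl_compl]

theorem ellSet_mono {p q : ℝ} (hp : 0 < p) (hpq : p ≤ q) : ellSet p ⊆ ellSet q := by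
  intro x hx
  have hx' : Summable fun n => |x n| ^ p := hx
  refine Summable.of_norm_bounded_eventually hx' ?_
  filter_upwards [hx'.tendsto_cofinite_zero.eventually (gt_mem_nhds one_pos)] with n hn
  have h1 : |x n| ≤ 1 := by
    by_contra! h
    exact hn.not_ge (Real.one_le_rpow h.le hp.le)
  rw [Real.norm_of_nonneg (by positivity)]
  rcases (abs_nonneg (x n)).eq_or_lt with h0 | h0
  · rw [← h0, Real.zero_rpow hp.ne', Real.zero_rpow (hp.trans_le hpq).ne']
  · exact Real.rpow_le_rpow_of_exponent_ge h0 h1 hpq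

theorem smul_mem_ellSet_iff {p c : ℝ} (hc : c ≠ 0) {x : ℕ → ℝ} :
    (fun n => c * x n) ∈ ellSet p ↔ x ∈ ellSet p := by
  have h : ∀ n, |c * x n| ^ p = |c| ^ p * |x n| ^ p := fun n => by
    rw [abs_mul, Real.mul_rpow (abs_nonneg _) (abs_nonneg _)]
  change (Summable fun n => |c * x n| ^ p) ↔ Summable fun n => |x n| ^ p
  simp only [h]
  exact summable_mul_left_iff (Real.rpow_pos_of_pos (abs_pos.2 hc) p).ne'

theorem smul_mem_ellAboveSet_iff {a c : ℝ} (hc : c ≠ 0) {x : ℕ → ℝ} :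
    (fun n => c * x n) ∈ ellAboveSet a ↔ x ∈ ellAboveSet a := by
  simp only [ellAboveSet, mem_iInter, smul_mem_ellSet_iff hc]

/-- By monotonicity in the exponent, a sequence of exponents decreasing to `a` suffices; this makes
the intersection countable. -/
theorem ellAboveSet_eq_iInter_nat {a : ℝ} (ha : 0 ≤ a) :
    ellAboveSet a = ⋂ k : ℕ, ellSet (a + 1 / ((k : ℝ) + 1)) := by
  refine Subset.antisymm (subset_iInter fun k => biInter_subset_of_mem ?_)
    (subset_iInter₂ fun p hp => ?_)
  · have : (0 : ℝ) < 1 / ((k : ℝ) + 1) := by positivity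
    exact lt_add_of_pos_right a this
  · obtain ⟨k, hk⟩ := exists_nat_one_div_lt (sub_pos.2 hp)
    exact (iInter_subset _ k).trans (ellSet_mono (by positivity) (by linarith))

/-- A series of nonnegative terms converges iff its partial sums have a natural bound `M`, and for
fixed `M` this is a closed condition. -/
theorem isSigma_two_preimage_ellSet {Y : Type*} [TopologicalSpace Y] {p : ℝ} (hp : 0 ≤ p)
    {x : Y → ℕ → ℝ} (hx : ∀ n, Continuous fun y => x y n) :
    IsSigma 2 {y | x y ∈ ellSet p} := by
  refine ⟨fun M => {y | ∀ N, ∑ n ∈ Finset.range N, |x y n| ^ p ≤ M}, fun M => ?_, ?_⟩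
  · change IsOpen _
    rw [isOpen_compl_iff]
    dsimp only
    rw [ofPred_forall]
    refine isClosed_iInter fun N => isClosed_le (continuous_finsetSum _ fun n _ => ?_)
      continuous_const
    exact (hx n).abs.rpow_const fun _ => Or.inr hp
  · ext y
    rw [mem_iUnion]
    constructor
    · intro hy
      have hy' : Summable fun n => |x y n| ^ p := hy
      obtain ⟨M, hM⟩ := exists_nat_ge (∑' n, |x y n| ^ p)
      exact ⟨M, fun N => (hy'.sum_le_tsum _ fun n _ => by positivity).trans hM⟩
    · rintro ⟨M, hM⟩
      exact summable_of_sum_range_le (fun n => by positivity) hM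

theorem isSigma_four_someRowIn {Y : Type*} [TopologicalSpace Y] {a : ℝ} (ha : 0 ≤ a)
    {seq : Y → ℕ → ℝ} (hseq : ∀ n, Continuous fun y => seq y n) :
    IsSigma 4 (someRowIn a seq) := by
  refine ⟨fun m => {y | row (seq y) m ∈ ellAboveSet a}, fun m => ?_, ?_⟩
  · refine ⟨fun k => {y | row (seq y) m ∈ ellSet (a + 1 / ((k : ℝ) + 1))}ᶜ, fun k => ?_, ?_⟩
    · rw [compl_compl]
      exact isSigma_two_preimage_ellSet (by positivity) fun n => hseq _
    · rw [ellAboveSet_eq_iInter_nat ha, ← compl_iInter]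
      congr 1
      ext y
      simp
  · ext y
    simp [someRowIn]

theorem compl_someRowIn {Y : Type*} (a : ℝ) (seq : Y → ℕ → ℝ) :
    (someRowIn a seq)ᶜ = noRowIn a seq := by
  ext y
  simp [someRowIn, noRowIn]

theorem IsSigmaComplete.compl {X : Type*} [TopologicalSpace X] {n : ℕ} {P : Set X}
    (h : IsSigmaComplete.{u} n P) : IsPiComplete.{u} n Pᶜ := by
  refine ⟨isPi_compl_iff.2 h.1, fun Z _ _ hZ A hA => ?_⟩
  obtain ⟨f, hf, hAf⟩ := h.2 Z hZ Aᶜ hA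
  exact ⟨f, hf, by rw [preimage_compl, ← hAf, compl_compl]⟩

/-! ### Sequences with prescribed summability -/

/-- For `s < r` there are finite constant blocks, of large sum of `s`-th powers and small sum of
`p`-th powers for all `p ≥ r`. -/
theorem exists_block {s r ε : ℝ} (hs : 0 < s) (hsr : s < r) (hε : 0 < ε) :
    ∃ (N : ℕ) (v : ℝ), 0 < v ∧ 1 ≤ N * v ^ s ∧ ∀ p, r ≤ p → N * v ^ p ≤ ε := by
  have hd : 0 < r - s := sub_pos.2 hsr
  -- With `v ^ (r - s) = η` and `N = ⌈v ^ (-s)⌉`, the `p`-th powers sum to at most `2 * η`. The cap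
  -- at `1` gives `v ≤ 1`, so rounding up at most doubles and larger exponents only decrease the
  -- sum.
  set η := min (ε / 2) 1
  have hη : 0 < η := lt_min (by positivity) one_pos
  have hη1 : η ≤ 1 := min_le_right _ _
  set v := η ^ (1 / (r - s))
  have hv : 0 < v := Real.rpow_pos_of_pos hη _
  have hv1 : v ≤ 1 := Real.rpow_le_one hη.le hη1 (by positivity)
  have hvη : v ^ (r - s) = η := by
    rw [← Real.rpow_mul hη.le, one_div_mul_cancel hd.ne', Real.rpow_one]
  have hvs : 0 < v ^ s := Real.rpow_pos_of_pos hv _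
  have hvs1 : v ^ s ≤ 1 := Real.rpow_le_one hv.le hv1 hs.le
  refine ⟨⌈1 / v ^ s⌉₊, v, hv, ?_, fun p hp => ?_⟩
  · exact (div_le_iff₀ hvs).1 (Nat.le_ceil _)
  · have h1 : (⌈1 / v ^ s⌉₊ : ℝ) ≤ 2 / v ^ s := by
      have h2 := (Nat.ceil_lt_add_one (show 0 ≤ 1 / v ^ s by positivity)).le
      have h3 : 1 ≤ 1 / v ^ s := (one_le_div hvs).2 hvs1
      calc _ ≤ 1 / v ^ s + 1 := h2
        _ ≤ 1 / v ^ s + 1 / v ^ s := by linarith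
        _ = 2 / v ^ s := by ring
    calc (⌈1 / v ^ s⌉₊ : ℝ) * v ^ p ≤ 2 / v ^ s * v ^ r :=
          mul_le_mul h1 (Real.rpow_le_rpow_of_exponent_ge hv hv1 hp) (by positivity)
            (by positivity)
      _ = 2 * v ^ (r - s) := by rw [Real.rpow_sub hv]; ring
      _ ≤ ε := by rw [hvη]; linarith [min_le_left (ε / 2) 1]

/-- The family indexed by `(b, l)` that is constant with value `v b` on the first `N b` indices
`l` of the blocks `b ∈ s`, and zero elsewhere. -/
noncomputable def blockFamily {ι : Type*} (N : ι → ℕ) (v : ι → ℝ) (s : Set ι) (x : ι × ℕ) : ℝ :=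
  open Classical in if x.1 ∈ s ∧ x.2 < N x.1 then v x.1 else 0

theorem blockFamily_summable_iff {ι : Type*} {N : ι → ℕ} {v : ι → ℝ} (hv : ∀ b, 0 < v b)
    (s : Set ι) {p : ℝ} (hp : 0 < p) :
    (Summable fun x => |blockFamily N v s x| ^ p) ↔
      Summable (s.indicator fun b => N b * v b ^ p) := by
  have hzero : ∀ b, ∀ l ∉ Finset.range (N b), |blockFamily N v s (b, l)| ^ p = 0 := by
    intro b l hl
    have hl' : ¬ l < N b := by simpa using hl
    simp [blockFamily, hl', Real.zero_rpow hp.ne']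
  rw [summable_prod_of_nonneg fun x => by positivity]
  have hsum : (fun b => ∑' l, |blockFamily N v s (b, l)| ^ p) =
      s.indicator fun b => N b * v b ^ p := by
    funext b
    rw [tsum_eq_sum (hzero b)]
    by_cases hb : b ∈ s
    · rw [indicator_of_mem hb, Finset.sum_congr rfl (g := fun _ => v b ^ p)]
      · simp
      · intro l hl
        have hl' : l < N b := by simpa using hl
        simp [blockFamily, hb, hl', abs_of_pos (hv b)]
    · simp [blockFamily, hb, Real.zero_rpow hp.ne']
  rw [hsum, and_iff_right]
  exact fun b => summable_of_ne_finset_zero (hzero b)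

theorem abs_blockFamily_le {ι : Type*} {N : ι → ℕ} {v : ι → ℝ} (hv : ∀ b, 0 < v b)
    (s : Set ι) (x : ι × ℕ) : |blockFamily N v s x| ≤ blockFamily N v univ x := by
  have := hv x.1
  by_cases h1 : x.1 ∈ s <;> by_cases h2 : x.2 < N x.1 <;> simp [blockFamily, h1, h2, this.le, abs_of_pos this]

/-- Clopen sets have empty frontier, so switching a block on or off is continuous in `z`. -/
theorem continuous_blockFamily {ι Z : Type*} [TopologicalSpace Z] (N : ι → ℕ) (v : ι → ℝ)
    {D : ι → Set Z} (hD : ∀ b, IsClopen (D b)) (x : ι × ℕ) :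
    Continuous fun z => blockFamily N v {b | z ∈ D b} x := by
  classical
  by_cases h : x.2 < N x.1
  · simp only [blockFamily, h, and_true, mem_ofPred_eq]
    exact continuous_const.if (fun z hz => by
      rw [show {z | z ∈ D x.1} = D x.1 from rfl, (hD x.1).frontier_eq] at hz
      exact hz.elim) continuous_const
  · simpa [blockFamily, h] using continuous_const

/-- The bound is uniform in the `Π⁰₃` set and in the space. -/
theorem exists_row_reduction {a q : ℝ} (ha : 0 ≤ a) (haq : a < q) :
    ∃ t ∈ ellSet q, ∀ (Z : Type u) [TopologicalSpace Z] [SecondCountableTopology Z],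
      IsZeroDim Z → ∀ F : Set Z, IsPi 3 F → ∃ g : Z → ℕ → ℝ,
        (∀ n, Continuous fun z => g z n) ∧ (∀ z n, |g z n| ≤ t n) ∧
        ∀ z, g z ∈ ellAboveSet a ↔ z ∈ F := by
  set r : ℕ → ℝ := fun k => a + (q - a) / ((k : ℝ) + 1) with hr
  have hqa : 0 < q - a := sub_pos.2 haq
  have har : ∀ k, a < r k := fun k => lt_add_of_pos_right a (by positivity)
  have hr_anti : StrictAnti r := strictAnti_nat_of_succ_lt fun k => by
    simp only [hr]
    gcongr
    linarith
  have hr0 : r 0 = q := by simp [hr]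
  have hr_lim : ∀ p, a < p → ∃ K, r K ≤ p := fun p hp => by
    obtain ⟨K, hK⟩ := exists_nat_one_div_lt (div_pos (sub_pos.2 hp) hqa)
    refine ⟨K, ?_⟩
    rw [lt_div_iff₀ hqa, one_div_mul_eq_div] at hK
    simp only [hr]
    linarith
  choose N v hv hNv1 hNv2 using fun b : ℕ × ℕ => exists_block (ε := (1 / 2) ^ b.1 * (1 / 2) ^ b.2)
    (ha.trans_lt (har (b.1 + 1))) (hr_anti (Nat.lt_succ_self b.1)) (by positivity)
  have hsum : Summable fun b : ℕ × ℕ => (1 / 2 : ℝ) ^ b.1 * (1 / 2) ^ b.2 :=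
    summable_geometric_two.mul_of_nonneg summable_geometric_two (fun _ => by positivity)
      fun _ => by positivity
  obtain ⟨e⟩ : Nonempty (ℕ ≃ (ℕ × ℕ) × ℕ) := nonempty_equiv_of_countable
  have hmem : ∀ (s : Set (ℕ × ℕ)) {p : ℝ}, 0 < p →
      ((fun n => blockFamily N v s (e n)) ∈ ellSet p ↔
        Summable (s.indicator fun b => N b * v b ^ p)) := fun s p hp => by
    rw [← blockFamily_summable_iff hv s hp]
    exact e.summable_iff (f := fun x => |blockFamily N v s x| ^ p)
  -- The bound has every block switched on, hence does not depend on `Z` or `F`.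
  refine ⟨fun n => blockFamily N v univ (e n), ?_, fun Z _ _ hZ F hF => ?_⟩
  · rw [hmem univ (ha.trans_lt haq), indicator_univ]
    refine Summable.of_nonneg_of_le (fun b => ?_) (fun b => hNv2 b q ?_) hsum
    · have := hv b
      positivity
    · rw [← hr0]
      exact hr_anti.antitone (Nat.zero_le _)
  · obtain ⟨G, hG, hFG⟩ := hF
    choose D hD hDfin using fun k => hZ.exists_clopen_finite_iff (hG k)
    have hF : ∀ z, z ∈ F ↔ ∀ k, {i | z ∈ D k i}.Finite := fun z => by
      rw [← notMem_compl_iff, hFG]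
      simp [← hDfin]
    refine ⟨fun z n => blockFamily N v {b : ℕ × ℕ | z ∈ D b.1 b.2} (e n), fun n => ?_,
      fun z n => abs_blockFamily_le hv _ _, fun z => ?_⟩
    · exact continuous_blockFamily N v (D := fun b : ℕ × ℕ => D b.1 b.2) (fun b => hD _ _) _
    · rw [hF]
      constructor
      -- Each active block of level `k` contributes at least `1` to the sum of `r (k + 1)`-th
      -- powers, so only finitely many are active.
      · intro h k
        by_contra hinf
        have hk : Summable _ := (hmem _ (ha.trans_lt (har (k + 1)))).1 (mem_iInter₂.1 h _ (har _))
        have hev := hk.tendsto_cofinite_zero.eventually (gt_mem_nhds one_pos)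
        refine hinf (Finite.of_finite_image ((mem_cofinite.1 hev).subset ?_)
          (Prod.mk_right_injective k).injOn)
        rintro _ ⟨i, hi, rfl⟩
        simp only [mem_compl_iff, mem_ofPred_eq, not_lt]
        rw [indicator_of_mem (by exact hi)]
        exact hNv1 (k, i)
      · intro h
        refine mem_iInter₂.2 fun p hp => (hmem _ (ha.trans_lt hp)).2 ?_
        -- From level `K` on, `p ≥ r k` and the block sums are dominated by `hsum`; below `K` only
        -- finitely many blocks are active.
        obtain ⟨K, hK⟩ := hr_lim p hp
        refine Summable.of_norm_bounded_eventually hsum ?_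
        refine (((finite_Iio K).biUnion fun k _ => (h k).image (Prod.mk k))).subset ?_
        rintro ⟨k, i⟩ hki
        by_contra hnot
        refine hki ?_
        simp only [mem_ofPred_eq]
        have hv0 := hv (k, i)
        by_cases hz : z ∈ D k i
        · rw [indicator_of_mem (by exact hz), Real.norm_of_nonneg (by positivity)]
          refine hNv2 (k, i) p (le_trans (hr_anti.antitone ?_) hK)
          by_contra! hlt
          exact hnot (mem_biUnion (show k ∈ Iio K from hlt) ⟨i, hz, rfl⟩)
        · rw [indicator_of_notMem (by exact hz), norm_zero]
          positivity

/-- Combines the reductions of the rows to one of double sequences. -/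
theorem exists_double_reduction {a q : ℝ} (ha : 0 ≤ a) (haq : a < q) :
    ∃ t ∈ ellSet q, ∀ (Z : Type u) [TopologicalSpace Z] [SecondCountableTopology Z],
      IsZeroDim Z → ∀ A : Set Z, IsSigma 4 A → ∃ x : Z → ℕ → ℝ,
        (∀ n, Continuous fun z => x z n) ∧ (∀ z n, |x z n| ≤ t n) ∧
        ∀ z, (∃ m, row (x z) m ∈ ellAboveSet a) ↔ z ∈ A := by
  obtain ⟨t, ht, hred⟩ := exists_row_reduction.{u} ha haq
  have hq := ha.trans_lt haq
  set d := Equiv.ofBijective _ diagIndex_bijective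
  have hd : ∀ m n, d.symm (diagIndex m n) = (m, n) := fun m n =>
    d.symm_apply_eq.2 rfl
  -- The weights make the bound `ℓ^q`-summable over all rows; being nonzero, they do not affect
  -- membership of a row.
  refine ⟨fun s => (1 / 2) ^ (d.symm s).1 * t (d.symm s).2, ?_, fun Z _ _ hZ A hA => ?_⟩
  · have hc : Summable fun m : ℕ => ((1 / 2 : ℝ) ^ q) ^ m :=
      summable_geometric_of_lt_one (by positivity)
        (Real.rpow_lt_one (by norm_num) (by norm_num) hq)
    have hprod := hc.mul_of_nonneg ht (fun _ => by positivity) fun _ => by positivity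
    refine (d.symm.summable_iff.2 hprod).congr fun s => ?_
    simp only [Function.comp_apply]
    have hpos : (0 : ℝ) < (1 / 2) ^ (d.symm s).1 := by positivity
    rw [abs_mul, Real.mul_rpow (abs_nonneg _) (abs_nonneg _), abs_of_pos hpos,
      Real.rpow_pow_comm (by norm_num)]
  · obtain ⟨F, hF, rfl⟩ := hA
    choose g hg hgt hgF using fun m => hred Z hZ (F m) (hF m)
    refine ⟨fun z s => (1 / 2) ^ (d.symm s).1 * g (d.symm s).1 z (d.symm s).2, fun s => ?_,
      fun z s => ?_, fun z => ?_⟩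
    · exact (hg _ _).const_smul ((1 / 2 : ℝ) ^ (d.symm s).1)
    · rw [abs_mul, abs_of_pos (by positivity)]
      exact mul_le_mul_of_nonneg_left (hgt _ _ _) (by positivity)
    · rw [mem_iUnion]
      refine exists_congr fun m => ?_
      have : row (fun s => (1 / 2) ^ (d.symm s).1 * g (d.symm s).1 z (d.symm s).2) m =
          fun n => (1 / 2) ^ m * g m z n := by
        funext n
        simp only [row, hd]
      rw [this, smul_mem_ellAboveSet_iff (by positivity), hgF]

/-- Completeness holds in every space of sequences with continuous coordinates into which every family of sequences that
is coordinatewise continuous and dominated in `ℓ^q` maps continuously. -/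
theorem isSigmaComplete_someRowIn {Y : Type} [TopologicalSpace Y] {a q : ℝ} (ha : 0 ≤ a)
    (haq : a < q) {seq : Y → ℕ → ℝ} (hseq : ∀ n, Continuous fun y => seq y n)
    (hlift : ∀ t ∈ ellSet q, ∀ (Z : Type u) [TopologicalSpace Z] (x : Z → ℕ → ℝ),
      (∀ n, Continuous fun z => x z n) → (∀ z n, |x z n| ≤ t n) →
      ∃ f : Z → Y, Continuous f ∧ ∀ z, seq (f z) = x z) :
    IsSigmaComplete.{u} 4 (someRowIn a seq) ∧ IsPiComplete.{u} 4 (noRowIn a seq) := by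
  have h : IsSigmaComplete.{u} 4 (someRowIn a seq) := by
    refine ⟨isSigma_four_someRowIn ha hseq, fun Z _ _ hZ A hA => ?_⟩
    obtain ⟨t, ht, hred⟩ := exists_double_reduction.{u} ha haq
    obtain ⟨x, hx, hxt, hxA⟩ := hred Z hZ A hA
    obtain ⟨f, hf, hfx⟩ := hlift t ht Z x hx hxt
    refine ⟨f, hf, ?_⟩
    ext z
    rw [← hxA, mem_preimage, someRowIn, mem_ofPred_eq, hfx]
  exact ⟨h, compl_someRowIn a seq ▸ h.compl⟩

/-! ### Continuity into and out of the sequence spaces -/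

theorem mem_ellSet_of_dominated {q : ℝ} (hq : 0 ≤ q) {t x : ℕ → ℝ} (ht : t ∈ ellSet q)
    (h : ∀ n, |x n| ≤ t n) : x ∈ ellSet q := by
  refine Summable.of_nonneg_of_le (fun n => by positivity) (fun n => ?_) ht
  exact Real.rpow_le_rpow (abs_nonneg _) ((h n).trans (le_abs_self _)) hq

/-- The Weierstrass test with majorant `|2 * t n| ^ q` turns coordinatewise continuity into
continuity for the metric. -/
theorem continuous_ellDist_of_dominated {Z : Type*} [TopologicalSpace Z] {q : ℝ} (hq : 0 < q)
    {t : ℕ → ℝ} (ht : t ∈ ellSet q) {x : Z → ℕ → ℝ} (hx : ∀ n, Continuous fun z => x z n)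
    (hxt : ∀ z n, |x z n| ≤ t n) (z₀ : Z) : Continuous fun z => ellDist q (x z) (x z₀) := by
  have hsum : Continuous fun z => ∑' n, |x z n - x z₀ n| ^ q := by
    refine continuous_tsum (u := fun n => |2 * t n| ^ q) (fun n => ?_)
      ((smul_mem_ellSet_iff two_ne_zero).2 ht) fun n z => ?_
    · exact ((hx n).sub continuous_const).abs.rpow_const fun _ => Or.inr hq.le
    · rw [Real.norm_of_nonneg (by positivity)]
      refine Real.rpow_le_rpow (abs_nonneg _) (le_trans ?_ (le_abs_self _)) hq.le
      linarith [abs_sub (x z n) (x z₀ n), hxt z n, hxt z₀ n]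
  unfold ellDist
  split_ifs
  · exact hsum.rpow_const fun _ => Or.inr (by positivity)
  · exact hsum

theorem abs_sub_lt_of_ellDist_lt {p ε : ℝ} (hp : 0 < p) (hε : 0 < ε) {x y : ℕ → ℝ}
    (hx : x ∈ ellSet p) (hy : y ∈ ellSet p)
    (h : ellDist p x y < if 1 ≤ p then ε else ε ^ p) (n : ℕ) : |x n - y n| < ε := by
  have hle : |x n - y n| ^ p ≤ ∑' n, |x n - y n| ^ p :=
    (ellSet_sub hp hx hy).le_tsum n fun _ _ => by positivity
  refine (Real.rpow_lt_rpow_iff (abs_nonneg _) hε.le hp).1 (hle.trans_lt ?_)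
  unfold ellDist at h
  split_ifs at h
  · rwa [one_div, Real.rpow_inv_lt_iff_of_pos (tsum_nonneg fun n => by positivity) hε.le hp] at h
  · exact h

theorem Ell.continuous_seq {q : ℝ} (hq : 0 < q) (n : ℕ) :
    Continuous fun y : Ell q hq => y.seq n := by
  refine Metric.continuous_iff.2 fun y ε hε => ⟨if 1 ≤ q then ε else ε ^ q, ?_, fun x hx => ?_⟩
  · split_ifs <;> positivity
  · exact abs_sub_lt_of_ellDist_lt hq hε x.mem y.mem hx n

theorem EllAbove.continuous_seq {b : ℝ} (e : ExponentSeq b) (n : ℕ) :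
    Continuous fun y : EllAbove b e => y.seq n := by
  refine Metric.continuous_iff.2 fun y ε hε => ?_
  obtain ⟨δ, hδ, hδε⟩ : ∃ δ : ℝ, 0 < δ ∧ δ = if 1 ≤ e.exp 0 then ε else ε ^ e.exp 0 :=
    ⟨_, by split_ifs <;> positivity, rfl⟩
  -- The term `i = 0` of the metric, of weight `1/2`, suffices because `s / (1 + s)` is increasing.
  refine ⟨1 / 2 * (δ / (1 + δ)), by positivity, fun x hx => ?_⟩
  refine abs_sub_lt_of_ellDist_lt (e.pos 0) hε (x.mem_ell 0) (y.mem_ell 0) ?_ n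
  rw [← hδε]
  have h0 := ellDist_nonneg (e.exp 0) x.seq y.seq
  have h1 : (1 / 2 : ℝ) ^ (0 + 1) *
      (ellDist (e.exp 0) x.seq y.seq / (1 + ellDist (e.exp 0) x.seq y.seq)) ≤ dist x y :=
    (ellAboveDist_summable e x.seq y.seq).le_tsum 0 fun i _ => ellAboveDist_term_nonneg e _ _ i
  have h2 := h1.trans_lt hx
  rw [zero_add, pow_one, mul_lt_mul_iff_right₀ (by norm_num),
    div_lt_div_iff₀ (by positivity) (by positivity)] at h2
  linarith

theorem Ell.exists_lift {q : ℝ} (hq : 0 < q) {Z : Type*} [TopologicalSpace Z] {t : ℕ → ℝ}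
    (ht : t ∈ ellSet q) {x : Z → ℕ → ℝ} (hx : ∀ n, Continuous fun z => x z n)
    (hxt : ∀ z n, |x z n| ≤ t n) : ∃ f : Z → Ell q hq, Continuous f ∧ ∀ z, (f z).seq = x z := by
  refine ⟨fun z => ⟨x z, mem_ellSet_of_dominated hq.le ht (hxt z)⟩, ?_, fun z => rfl⟩
  refine continuous_iff_continuousAt.2 fun z₀ => tendsto_iff_dist_tendsto_zero.2 ?_
  have h := (continuous_ellDist_of_dominated hq ht hx hxt z₀).tendsto z₀
  rwa [ellDist_self hq] at h

/-- A bound in `ℓ^b` lies in every `ℓ^{pᵢ}`, so each `dᵢ` is continuous along the family, and the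
weights `2^{-(i+1)}` make the series of the metric converge uniformly. -/
theorem EllAbove.exists_lift {b : ℝ} (hb : 0 < b) (e : ExponentSeq b) {Z : Type*}
    [TopologicalSpace Z] {t : ℕ → ℝ} (ht : t ∈ ellSet b) {x : Z → ℕ → ℝ}
    (hx : ∀ n, Continuous fun z => x z n) (hxt : ∀ z n, |x z n| ≤ t n) :
    ∃ f : Z → EllAbove b e, Continuous f ∧ ∀ z, (f z).seq = x z := by
  refine ⟨fun z => ⟨x z, mem_iInter₂.2 fun p hp =>
    ellSet_mono hb (le_of_lt hp) (mem_ellSet_of_dominated hb.le ht (hxt z))⟩, ?_, fun z => rfl⟩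
  refine continuous_iff_continuousAt.2 fun z₀ => tendsto_iff_dist_tendsto_zero.2 ?_
  have hcont : Continuous fun z => ellAboveDist e (x z) (x z₀) := by
    refine continuous_tsum (u := fun i => (1 / 2 : ℝ) ^ (i + 1)) (fun i => ?_)
      ((summable_nat_add_iff 1).2 summable_geometric_two) fun i z => ?_
    · have hi := continuous_ellDist_of_dominated (e.pos i) (ellSet_mono hb (e.gt i).le ht) hx hxt z₀
      refine continuous_const.mul (hi.div (continuous_const.add hi) fun z => ?_)
      have := ellDist_nonneg (e.exp i) (x z) (x z₀)
      positivity
    · rw [Real.norm_of_nonneg (ellAboveDist_term_nonneg e _ _ i)]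
      have h := ellDist_nonneg (e.exp i) (x z) (x z₀)
      exact mul_le_of_le_one_right (by positivity) ((div_le_one (by positivity)).2 (by linarith))
  have h := hcont.tendsto z₀
  have h0 : ellAboveDist e (x z₀) (x z₀) = 0 := by simp [ellAboveDist, ellDist_self (e.pos _)]
  rwa [h0] at h

theorem tendsto_zero_of_mem_ellSet {q : ℝ} (hq : 0 < q) {x : ℕ → ℝ} (hx : x ∈ ellSet q) :
    Tendsto x atTop (𝓝 0) := by
  have h := (Summable.tendsto_atTop_zero hx).rpow_const (p := 1 / q) (Or.inr (by positivity))
  rw [Real.zero_rpow (by positivity)] at h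
  refine tendsto_zero_iff_abs_tendsto_zero _ |>.2 (h.congr fun n => ?_)
  rw [← Real.rpow_mul (abs_nonneg _), mul_one_div_cancel hq.ne', Real.rpow_one]
  rfl

theorem EllInfty.continuous_apply (n : ℕ) : Continuous fun y : EllInfty => y n := by
  refine continuous_iff_continuousAt.2 fun y => tendsto_iff_dist_tendsto_zero.2 ?_
  refine squeeze_zero (fun _ => dist_nonneg) (fun x => ?_)
    (tendsto_iff_dist_tendsto_zero.1 (tendsto_id (x := 𝓝 y)))
  rw [dist_eq_norm, dist_eq_norm]
  exact lp.norm_apply_le_norm ENNReal.top_ne_zero (x - y) n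

theorem Ell.mem_lp_top {q : ℝ} {hq : 0 < q} (x : Ell q hq) :
    Memℓp (E := fun _ => ℝ) x.seq ⊤ :=
  memℓp_infty_iff.2 (tendsto_zero_of_mem_ellSet hq x.mem).norm.bddAbove_range

/-- The inclusion of `ℓ^q` in `ℓ^∞`. -/
noncomputable def Ell.toEllInfty {q : ℝ} {hq : 0 < q} (x : Ell q hq) : EllInfty :=
  ⟨x.seq, x.mem_lp_top⟩

theorem Ell.continuous_toEllInfty {q : ℝ} (hq : 0 < q) :
    Continuous (Ell.toEllInfty : Ell q hq → EllInfty) := by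
  refine Metric.continuous_iff.2 fun y ε hε =>
    ⟨if 1 ≤ q then ε / 2 else (ε / 2) ^ q, ?_, fun x hx => ?_⟩
  · split_ifs <;> positivity
  · rw [dist_eq_norm]
    refine lt_of_le_of_lt (lp.norm_le_of_forall_le (half_pos hε).le fun n => ?_) (half_lt_self hε)
    exact (abs_sub_lt_of_ellDist_lt hq (half_pos hε) x.mem y.mem hx n).le

theorem corollary3 (a : ℝ) (ha : 0 ≤ a) :
    (∀ (q : ℝ) (haq : a < q),
      IsSigmaComplete.{u, 0} 4 (someRowIn a (Ell.seq (hq := ha.trans_lt haq))) ∧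
      IsPiComplete.{u, 0} 4 (noRowIn a (Ell.seq (hq := ha.trans_lt haq)))) ∧
    (∀ (b : ℝ) (_ : a < b) (e : ExponentSeq b),
      IsSigmaComplete.{u, 0} 4 (someRowIn a (EllAbove.seq (e := e))) ∧
      IsPiComplete.{u, 0} 4 (noRowIn a (EllAbove.seq (e := e)))) ∧
    (IsSigmaComplete.{u, 0} 4 (someRowIn a (fun x : cZero => (x : EllInfty))) ∧
      IsPiComplete.{u, 0} 4 (noRowIn a (fun x : cZero => (x : EllInfty)))) ∧
    (IsSigmaComplete.{u, 0} 4 (someRowIn a (fun x : EllInfty => x)) ∧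
      IsPiComplete.{u, 0} 4 (noRowIn a (fun x : EllInfty => x))) := by
  -- For `c₀` and `ℓ^∞` any `q > a` would do: the reduction goes through `ℓ^{a+1}`, which embeds
  -- continuously.
  have ha1 : 0 < a + 1 := by positivity
  refine ⟨fun q haq => ?_, fun b hab e => ?_, ?_, ?_⟩
  · exact isSigmaComplete_someRowIn ha haq (Ell.continuous_seq _)
      fun t ht Z _ x hx hxt => Ell.exists_lift _ ht hx hxt
  · exact isSigmaComplete_someRowIn ha hab (EllAbove.continuous_seq e)
      fun t ht Z _ x hx hxt => EllAbove.exists_lift (ha.trans_lt hab) e ht hx hxt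
  · refine isSigmaComplete_someRowIn ha (lt_add_one a)
      (fun n => (EllInfty.continuous_apply n).comp continuous_subtype_val)
      fun t ht Z _ x hx hxt => ?_
    obtain ⟨f, hf, hfx⟩ := Ell.exists_lift ha1 ht hx hxt
    exact ⟨fun z => ⟨(f z).toEllInfty, tendsto_zero_of_mem_ellSet ha1 (f z).mem⟩,
      ((Ell.continuous_toEllInfty ha1).comp hf).subtype_mk _, hfx⟩
  · refine isSigmaComplete_someRowIn ha (lt_add_one a) EllInfty.continuous_apply
      fun t ht Z _ x hx hxt => ?_
    obtain ⟨f, hf, hfx⟩ := Ell.exists_lift ha1 ht hx hxt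
    exact ⟨fun z => (f z).toEllInfty, (Ell.continuous_toEllInfty ha1).comp hf, hfx⟩
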